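/- Rings are associative with identity and ring homomorphisms preserve the identity. Let $R$ be a ring. A ring homomorphism $f:R\to S$ is a ring epimorphism if $gf=hf$ implies $g=h$ for all ring homomorphisms $g,h:S\to T$. Call $S$ (with $f$) a perfect right ring of quotients of $R$ if $f$ is a ring epimorphism making $S$ a flat left $R$-module, a perfect left ring of quotients if $f$ is a ring epimorphism making $S$ a flat right $R$-module, and a perfect symmetric ring of quotients if $f$ is a ring epimorphism making $S$ flat both as a left and as a right $R$-module. Let $Q^r_{\max}(R)=\varinjlim \mathrm{Hom}_R(J,R)$ over the dense right ideals $J$ of $R$ be the maximal right ring of quotients, and $Q^l_{\max}(R)$ the maximal left ring of quotients, defined symmetrically. A right ideal $J$ is dense if for all $x,y\in R$ with $x\neq 0$ there is $r\in R$ with $xr\ne 0$ and $yr\in J$; dense left ideals are defined symmetrically. Let $Q^\sigma_{\max}(R)$ be the maximal symmetric ring of quotients: the ring of classes of compatible pairs $(f,g)$, where $f:I\to R$ is a homomorphism of left $R$-modules on a dense left ideal $I$, $g:J\to R$ is a homomorphism of right $R$-modules on a dense right ideal $J$, and $f(i)j=ig(j)$ for all $i\in I$, $j\in J$; two pairs $(f,g)$,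 $(h,k)$ are identified if $f=h$ on some dense left ideal and $g=k$ on some dense right ideal. Each of the three rings contains $R$ canonically. The total right ring of quotients $Q^r_{\mathrm{tot}}(R)$ is the directed union of all subrings of $Q^r_{\max}(R)$ that contain $R$ and for which the inclusion of $R$ is a perfect right ring of quotients; the total left ring of quotients $Q^l_{\mathrm{tot}}(R)\subseteq Q^l_{\max}(R)$ and the total symmetric ring of quotients $Q^\sigma_{\mathrm{tot}}(R)\subseteq Q^\sigma_{\max}(R)$ are defined in the same way with perfect left, respectively perfect symmetric, rings of quotients. Then there are injective ring homomorphisms $\varphi:Q^\sigma_{\mathrm{tot}}(R)\to Q^r_{\mathrm{tot}}(R)$ and $\psi:Q^\sigma_{\mathrm{tot}}(R)\to Q^l_{\mathrm{tot}}(R)$ that are the identity on $R$. Moreover, if $Q^r_{\mathrm{tot}}(R)$ and $Q^l_{\mathrm{tot}}(R)$ coincide as overrings of $R$, i.e. if there is a ring isomorphism $e:Q^r_{\mathrm{tot}}(R)\to Q^l_{\mathrm{tot}}(R)$ that is the identity on $R$, then all three rings coincide: $\varphi$ and $\psi$ are isomorphisms, and $e\varphi=\psi$ for every such $e$. -/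

import Mathlib

universe u v

open MulOpposite TensorProduct

namespace QuotRing

/-! ### Tensor products and flatness over a noncommutative ring

A right `R`-module is a `Module Rᵐᵒᵖ M`. -/

section Tensor

variable (R : Type u) [Ring R]

/-- The subgroup of `M ⊗[ℤ] N` generated by all `(m r) ⊗ n - m ⊗ (r n)`. -/
def balancedRel (M N : Type u) [AddCommGroup M] [AddCommGroup N] [Module Rᵐᵒᵖ M] [Module R N] :
    AddSubgroup (M ⊗[ℤ] N) :=
  AddSubgroup.closure
    {t | ∃ (m : M) (r : R) (n : N), t = (op r • m) ⊗ₜ[ℤ] n - m ⊗ₜ[ℤ] (r • n)}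

/-- The tensor product `M ⊗_R N` of a right `R`-module and a left `R`-module, an abelian group. -/
abbrev NCTensor (M N : Type u) [AddCommGroup M] [AddCommGroup N] [Module Rᵐᵒᵖ M] [Module R N] :
    Type u :=
  (M ⊗[ℤ] N) ⧸ balancedRel R M N

variable {R}

/-- `φ ⊗ ψ : M ⊗_R N → M' ⊗_R N'`. -/
def NCTensor.map {M M' N N' : Type u} [AddCommGroup M] [AddCommGroup M'] [AddCommGroup N]
    [AddCommGroup N'] [Module Rᵐᵒᵖ M] [Module Rᵐᵒᵖ M'] [Module R N] [Module R N']
    (φ : M →ₗ[Rᵐᵒᵖ] M') (ψ : N →ₗ[R] N') : NCTensor R M N →+ NCTensor R M' N' :=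
  QuotientAddGroup.map _ _
    (TensorProduct.map φ.toAddMonoidHom.toIntLinearMap
      ψ.toAddMonoidHom.toIntLinearMap).toAddMonoidHom <| by
    refine (AddSubgroup.closure_le _).2 ?_
    rintro _ ⟨m, r, n, rfl⟩
    refine AddSubgroup.subset_closure ⟨φ m, r, ψ n, ?_⟩
    rw [← map_smul, ← map_smul]
    exact map_sub (TensorProduct.map φ.toAddMonoidHom.toIntLinearMap
      ψ.toAddMonoidHom.toIntLinearMap).toAddMonoidHom _ _

variable (R)

/-- A left `R`-module `N` is flat if `- ⊗_R N` preserves injectivity. -/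
def FlatLeftModule (N : Type u) [AddCommGroup N] [Module R N] : Prop :=
  ∀ (M M' : Type u) [AddCommGroup M] [AddCommGroup M'] [Module Rᵐᵒᵖ M] [Module Rᵐᵒᵖ M']
    (φ : M →ₗ[Rᵐᵒᵖ] M'), Function.Injective φ →
      Function.Injective (NCTensor.map φ (LinearMap.id : N →ₗ[R] N))

/-- A right `R`-module `M` is flat if `M ⊗_R -` preserves injectivity. -/
def FlatRightModule (M : Type u) [AddCommGroup M] [Module Rᵐᵒᵖ M] : Prop :=
  ∀ (N N' : Type u) [AddCommGroup N] [AddCommGroup N'] [Module R N] [Module R N']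
    (ψ : N →ₗ[R] N'), Function.Injective ψ →
      Function.Injective (NCTensor.map (LinearMap.id : M →ₗ[Rᵐᵒᵖ] M) ψ)

end Tensor

/-! ### Perfect rings of quotients -/

section Perfect

variable {R S : Type u} [Ring R] [Ring S]

/-- Ring epimorphism: right cancellable in the category of rings. -/
def IsRingEpi (f : R →+* S) : Prop :=
  ∀ (T : Type u) [Ring T] (g h : S →+* T), g.comp f = h.comp f → g = h

/-- `f` makes `S` into a flat left `R`-module (`r • s = f r * s`). -/
def MakesLeftFlat (f : R →+* S) : Prop :=
  letI : Module R S := Module.compHom S f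
  FlatLeftModule R S

/-- `f` makes `S` into a flat right `R`-module (`s • r = s * f r`). -/
def MakesRightFlat (f : R →+* S) : Prop :=
  letI : Module Rᵐᵒᵖ S := Module.compHom S (RingHom.op f)
  FlatRightModule R S

/-- `f` makes `S` into a perfect right ring of quotients of `R`. -/
def IsPerfectRight (f : R →+* S) : Prop := IsRingEpi f ∧ MakesLeftFlat f

/-- `f` makes `S` into a perfect left ring of quotients of `R`. -/
def IsPerfectLeft (f : R →+* S) : Prop := IsRingEpi f ∧ MakesRightFlat f

/-- `f` makes `S` into a perfect symmetric ring of quotients of `R`. -/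
def IsPerfectSymm (f : R →+* S) : Prop := IsRingEpi f ∧ MakesLeftFlat f ∧ MakesRightFlat f

theorem isRingEpi_of_surjective {f : R →+* S} (hf : Function.Surjective f) : IsRingEpi f := by
  intro T _ g h hgh
  ext s
  obtain ⟨r, rfl⟩ := hf s
  exact DFunLike.congr_fun hgh r

theorem makesLeftFlat_of_bijective {f : R →+* S} (hf : Function.Bijective f) :
    MakesLeftFlat f := by
  letI : Module R S := Module.compHom S f
  have smul_eq : ∀ (r : R) (s : S), r • s = f r * s := fun _ _ => rfl
  let e := RingEquiv.ofBijective f hf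
  have he : ∀ s, f (e.symm s) = s := fun s => e.apply_symm_apply s
  intro M M' _ _ _ _ φ hφ
  let c : ∀ (N : Type u) [AddCommGroup N] [Module Rᵐᵒᵖ N], NCTensor R N S →+ N :=
    fun N _ _ => QuotientAddGroup.lift _
      (TensorProduct.liftAddHom
        (AddMonoidHom.mk' (fun n => AddMonoidHom.mk' (fun s => op (e.symm s) • n)
          fun a b => by simp [add_smul]) fun a b => by ext; simp [add_smul])
        fun z a b => by
          change op (e.symm b) • z • a = op (e.symm (z • b)) • a
          rw [map_zsmul, op_smul, smul_assoc, smul_comm]) <| by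
      refine (AddSubgroup.closure_le _).2 ?_
      rintro _ ⟨m, r, n, rfl⟩
      refine (map_sub _ _ _).trans (sub_eq_zero.2 ?_)
      change op (e.symm n) • op r • m = op (e.symm (f r * n)) • m
      have : e.symm (f r * n) = r * e.symm n := by
        rw [map_mul]; congr 1; exact e.symm_apply_apply r
      rw [this, op_mul, mul_smul]
  have key : ∀ t : NCTensor R M S, t = QuotientAddGroup.mk (c M t ⊗ₜ[ℤ] (1 : S)) := by
    intro t
    obtain ⟨t, rfl⟩ := QuotientAddGroup.mk_surjective t
    induction t with
    | zero =>
      rw [QuotientAddGroup.mk_zero, map_zero, TensorProduct.zero_tmul, QuotientAddGroup.mk_zero]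
    | add a b ha hb =>
      rw [QuotientAddGroup.mk_add, map_add, TensorProduct.add_tmul, QuotientAddGroup.mk_add,
        ← ha, ← hb]
    | tmul n s =>
      change _ = QuotientAddGroup.mk ((op (e.symm s) • n) ⊗ₜ[ℤ] (1 : S))
      symm
      rw [← sub_eq_zero, ← QuotientAddGroup.mk_sub, QuotientAddGroup.eq_zero_iff]
      refine AddSubgroup.subset_closure ⟨n, e.symm s, 1, ?_⟩
      rw [smul_eq, he, mul_one]
  have nat : ∀ t, c M' (NCTensor.map φ (LinearMap.id : S →ₗ[R] S) t) = φ (c M t) := by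
    intro t
    rw [key t]
    exact (map_smul φ (op (e.symm 1)) (c M t)).symm
  intro a b hab
  have := congrArg (c M') hab
  rw [nat, nat] at this
  rw [key a, key b, hφ this]

theorem makesRightFlat_of_bijective {f : R →+* S} (hf : Function.Bijective f) :
    MakesRightFlat f := by
  letI : Module Rᵐᵒᵖ S := Module.compHom S (RingHom.op f)
  have smul_eq : ∀ (r : R) (s : S), op r • s = s * f r := fun _ _ => rfl
  let e := RingEquiv.ofBijective f hf
  have he : ∀ s, f (e.symm s) = s := fun s => e.apply_symm_apply s
  intro M M' _ _ _ _ φ hφ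
  let c : ∀ (N : Type u) [AddCommGroup N] [Module R N], NCTensor R S N →+ N :=
    fun N _ _ => QuotientAddGroup.lift _
      (TensorProduct.liftAddHom
        (AddMonoidHom.mk' (fun s => AddMonoidHom.mk' (fun n => e.symm s • n)
          fun a b => by simp [add_smul]) fun a b => by ext; simp [add_smul])
        fun z a b => by
          change e.symm (z • a) • b = e.symm a • z • b
          rw [map_zsmul, smul_assoc, smul_comm]) <| by
      refine (AddSubgroup.closure_le _).2 ?_
      rintro _ ⟨m, r, n, rfl⟩
      refine (map_sub _ _ _).trans (sub_eq_zero.2 ?_)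
      change e.symm (m * f r) • n = e.symm m • r • n
      have : e.symm (m * f r) = e.symm m * r := by
        rw [map_mul]; congr 1; exact e.symm_apply_apply r
      rw [this, mul_smul]
  have key : ∀ t : NCTensor R S M, t = QuotientAddGroup.mk ((1 : S) ⊗ₜ[ℤ] c M t) := by
    intro t
    obtain ⟨t, rfl⟩ := QuotientAddGroup.mk_surjective t
    induction t with
    | zero =>
      rw [QuotientAddGroup.mk_zero, map_zero, TensorProduct.tmul_zero, QuotientAddGroup.mk_zero]
    | add a b ha hb =>
      rw [QuotientAddGroup.mk_add, map_add, TensorProduct.tmul_add, QuotientAddGroup.mk_add,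
        ← ha, ← hb]
    | tmul s n =>
      change _ = QuotientAddGroup.mk ((1 : S) ⊗ₜ[ℤ] (e.symm s • n))
      rw [← sub_eq_zero, ← QuotientAddGroup.mk_sub, QuotientAddGroup.eq_zero_iff]
      refine AddSubgroup.subset_closure ⟨1, e.symm s, n, ?_⟩
      rw [smul_eq, he, one_mul]
  have nat : ∀ t, c M' (NCTensor.map (LinearMap.id : S →ₗ[Rᵐᵒᵖ] S) φ t) = φ (c M t) := by
    intro t
    rw [key t]
    exact (map_smul φ (e.symm 1) (c M t)).symm
  intro a b hab
  have := congrArg (c M') hab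
  rw [nat, nat] at this
  rw [key a, key b, hφ this]

end Perfect

/-! ### Classes of partial endomorphisms with dense domain

For `A = Rᵐᵒᵖ`, `M = R` (resp. `A = R`, `M = R`) a dense submodule of `M` is a dense right
(resp. left) ideal of `R`. -/

section DenseEnd

variable {A : Type u} {M : Type v} [Ring A] [AddCommGroup M] [Module A M]

/-- A submodule `D` of `M` is dense if for all `x, y ∈ M` with `x ≠ 0` there is a scalar `a`
with `a x ≠ 0` and `a y ∈ D`. -/
def IsDenseSub (D : Submodule A M) : Prop :=
  ∀ x y : M, x ≠ 0 → ∃ a : A, a • x ≠ 0 ∧ a • y ∈ D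

theorem IsDenseSub.top : IsDenseSub (⊤ : Submodule A M) := fun _ _ hx => ⟨1, by simpa using hx⟩

theorem IsDenseSub.inf {D E : Submodule A M} (hD : IsDenseSub D) (hE : IsDenseSub E) :
    IsDenseSub (D ⊓ E) := by
  intro x y hx
  obtain ⟨a, ha, ha'⟩ := hD x y hx
  obtain ⟨b, hb, hb'⟩ := hE (a • x) (a • y) ha
  exact ⟨b * a, by rwa [mul_smul], by rw [mul_smul]; exact D.smul_mem b ha',
    by rwa [mul_smul]⟩

variable (A M)

/-- An `A`-linear map `D → M` defined on a dense submodule `D` of `M`. -/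
structure DensePMap where
  domain : Submodule A M
  dense : IsDenseSub domain
  toFun : domain →ₗ[A] M

variable {A M}

namespace DensePMap

/-- Two partial maps are identified if they agree on a dense submodule inside both domains. -/
def Agree (f g : DensePMap A M) : Prop :=
  ∃ D : Submodule A M, IsDenseSub D ∧ ∃ (hf : D ≤ f.domain) (hg : D ≤ g.domain),
    ∀ x : D, f.toFun ⟨x, hf x.2⟩ = g.toFun ⟨x, hg x.2⟩

theorem agree_iff (f g : DensePMap A M) : Agree f g ↔
    ∀ (x : M) (hf : x ∈ f.domain) (hg : x ∈ g.domain), f.toFun ⟨x, hf⟩ = g.toFun ⟨x, hg⟩ := by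
  constructor
  · rintro ⟨D, hD, hf, hg, h⟩ x hxf hxg
    by_contra hne
    obtain ⟨a, ha, hax⟩ := hD _ x (sub_ne_zero.2 hne)
    apply ha
    rw [smul_sub, ← map_smul, ← map_smul]
    exact sub_eq_zero.2 (h ⟨a • x, hax⟩)
  · intro h
    exact ⟨_, f.dense.inf g.dense, inf_le_left, inf_le_right, fun x => h _ _ _⟩

instance setoid (A : Type u) (M : Type v) [Ring A] [AddCommGroup M] [Module A M] :
    Setoid (DensePMap A M) where
  r := Agree
  iseqv :=
    { refl := fun f => (agree_iff f f).2 fun _ _ _ => rfl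
      symm := fun {f g} h => (agree_iff g f).2 fun x hg hf => ((agree_iff f g).1 h x hf hg).symm
      trans := by
        rintro f g h ⟨D, hD, hf, hg, e⟩ ⟨E, hE, hg', hh, e'⟩
        exact ⟨D ⊓ E, hD.inf hE, inf_le_left.trans hf, inf_le_right.trans hh,
          fun x => (e ⟨x, x.2.1⟩).trans (e' ⟨x, x.2.2⟩)⟩ }

/-- The everywhere defined map `φ`. -/
def ofEnd (φ : M →ₗ[A] M) : DensePMap A M where
  domain := ⊤
  dense := IsDenseSub.top
  toFun := φ ∘ₗ Submodule.subtype ⊤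

/-- The sum, on the intersection of the domains. -/
def add (f g : DensePMap A M) : DensePMap A M where
  domain := f.domain ⊓ g.domain
  dense := f.dense.inf g.dense
  toFun := f.toFun ∘ₗ Submodule.inclusion inf_le_left + g.toFun ∘ₗ Submodule.inclusion inf_le_right

/-- The negative, on the same domain. -/
def neg (f : DensePMap A M) : DensePMap A M where
  domain := f.domain
  dense := f.dense
  toFun := -f.toFun

/-- The composite `x ↦ f (g x)`, on `{x ∈ dom g | g x ∈ dom f}`. -/
def comp (f g : DensePMap A M) : DensePMap A M where
  domain :=
    { carrier := {x | ∃ h : x ∈ g.domain, g.toFun ⟨x, h⟩ ∈ f.domain}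
      zero_mem' := ⟨g.domain.zero_mem, by
        have : g.toFun ⟨0, g.domain.zero_mem⟩ = 0 := map_zero g.toFun
        rw [this]; exact f.domain.zero_mem⟩
      add_mem' := by
        rintro x y ⟨hx, hx'⟩ ⟨hy, hy'⟩
        refine ⟨g.domain.add_mem hx hy, ?_⟩
        have : g.toFun ⟨x + y, g.domain.add_mem hx hy⟩ = g.toFun ⟨x, hx⟩ + g.toFun ⟨y, hy⟩ :=
          map_add g.toFun ⟨x, hx⟩ ⟨y, hy⟩
        rw [this]; exact f.domain.add_mem hx' hy'
      smul_mem' := by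
        rintro a x ⟨hx, hx'⟩
        refine ⟨g.domain.smul_mem a hx, ?_⟩
        have : g.toFun ⟨a • x, g.domain.smul_mem a hx⟩ = a • g.toFun ⟨x, hx⟩ :=
          map_smul g.toFun a ⟨x, hx⟩
        rw [this]; exact f.domain.smul_mem a hx' }
  dense := by
    intro x y hx
    obtain ⟨a, ha, hay⟩ := g.dense x y hx
    obtain ⟨b, hb, hby⟩ := f.dense (a • x) (g.toFun ⟨a • y, hay⟩) ha
    refine ⟨b * a, by rwa [mul_smul], ?_⟩
    rw [mul_smul]
    refine ⟨g.domain.smul_mem b hay, ?_⟩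
    have : g.toFun ⟨b • a • y, g.domain.smul_mem b hay⟩ = b • g.toFun ⟨a • y, hay⟩ :=
      map_smul g.toFun b ⟨a • y, hay⟩
    rw [this]; exact hby
  toFun :=
    { toFun := fun x => f.toFun ⟨g.toFun ⟨x, x.2.1⟩, x.2.2⟩
      map_add' := fun x y => by
        rw [← map_add]; congr 1; apply Subtype.ext; exact map_add g.toFun ⟨x, x.2.1⟩ ⟨y, y.2.1⟩
      map_smul' := fun a x => by
        rw [RingHom.id_apply, ← map_smul]; congr 1; apply Subtype.ext
        exact map_smul g.toFun a ⟨x, x.2.1⟩ }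

theorem add_agree {f f' g g' : DensePMap A M} (hf : Agree f f') (hg : Agree g g') :
    Agree (add f g) (add f' g') := by
  rw [agree_iff] at *
  intro x h h'
  exact congrArg₂ (· + ·) (hf x h.1 h'.1) (hg x h.2 h'.2)

theorem neg_agree {f f' : DensePMap A M} (hf : Agree f f') : Agree (neg f) (neg f') := by
  rw [agree_iff] at *
  intro x h h'
  exact congrArg (- ·) (hf x h h')

theorem comp_agree {f f' g g' : DensePMap A M} (hf : Agree f f') (hg : Agree g g') :
    Agree (comp f g) (comp f' g') := by
  rw [agree_iff] at *
  rintro x ⟨h, hh⟩ ⟨h', hh'⟩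
  have e := hg x h h'
  change f.toFun ⟨g.toFun ⟨x, h⟩, hh⟩ = f'.toFun ⟨g'.toFun ⟨x, h'⟩, hh'⟩
  rw [hf _ hh (e ▸ hh')]
  congr 1
  exact Subtype.ext e

end DensePMap

variable (A M)

/-- The direct limit of `Hom_A(D, M)` over all dense submodules `D` of `M`. -/
def DenseEnd : Type v := Quotient (DensePMap.setoid A M)

variable {A M}

namespace DenseEnd

/-- The class of a partial map. -/
def mk (f : DensePMap A M) : DenseEnd A M := Quotient.mk _ f

theorem mk_eq_iff {f g : DensePMap A M} : mk f = mk g ↔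
    ∀ (x : M) (hf : x ∈ f.domain) (hg : x ∈ g.domain), f.toFun ⟨x, hf⟩ = g.toFun ⟨x, hg⟩ :=
  Quotient.eq.trans (DensePMap.agree_iff f g)

theorem mk_surjective (q : DenseEnd A M) : ∃ f, mk f = q := Quotient.exists_rep q

instance : Zero (DenseEnd A M) := ⟨mk (DensePMap.ofEnd 0)⟩
instance : One (DenseEnd A M) := ⟨mk (DensePMap.ofEnd LinearMap.id)⟩
instance : Add (DenseEnd A M) :=
  ⟨Quotient.map₂ DensePMap.add fun _ _ h _ _ h' => DensePMap.add_agree h h'⟩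
instance : Neg (DenseEnd A M) := ⟨Quotient.map DensePMap.neg fun _ _ h => DensePMap.neg_agree h⟩
instance : Mul (DenseEnd A M) :=
  ⟨Quotient.map₂ DensePMap.comp fun _ _ h _ _ h' => DensePMap.comp_agree h h'⟩

theorem mk_add (f g : DensePMap A M) : mk (f.add g) = mk f + mk g := rfl
theorem mk_mul (f g : DensePMap A M) : mk (f.comp g) = mk f * mk g := rfl
theorem mk_neg (f : DensePMap A M) : mk f.neg = -mk f := rfl
theorem mk_zero : mk (DensePMap.ofEnd (0 : M →ₗ[A] M)) = 0 := rfl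
theorem mk_one : mk (DensePMap.ofEnd (LinearMap.id : M →ₗ[A] M)) = 1 := rfl

/-- Addition is pointwise and multiplication is composition of partial maps. -/
instance : Ring (DenseEnd A M) :=
  Ring.ofMinimalAxioms
    (by
      intro a b c
      obtain ⟨f, rfl⟩ := mk_surjective a
      obtain ⟨g, rfl⟩ := mk_surjective b
      obtain ⟨h, rfl⟩ := mk_surjective c
      exact mk_eq_iff.2 fun x _ _ => add_assoc _ _ _)
    (by
      intro a
      obtain ⟨f, rfl⟩ := mk_surjective a
      exact mk_eq_iff.2 fun x _ _ => zero_add _)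
    (by
      intro a
      obtain ⟨f, rfl⟩ := mk_surjective a
      exact mk_eq_iff.2 fun x _ _ => neg_add_cancel _)
    (by
      intro a b c
      obtain ⟨f, rfl⟩ := mk_surjective a
      obtain ⟨g, rfl⟩ := mk_surjective b
      obtain ⟨h, rfl⟩ := mk_surjective c
      exact mk_eq_iff.2 fun x _ _ => rfl)
    (by
      intro a
      obtain ⟨f, rfl⟩ := mk_surjective a
      exact mk_eq_iff.2 fun x _ _ => rfl)
    (by
      intro a
      obtain ⟨f, rfl⟩ := mk_surjective a
      exact mk_eq_iff.2 fun x _ _ => rfl)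
    (by
      intro a b c
      obtain ⟨f, rfl⟩ := mk_surjective a
      obtain ⟨g, rfl⟩ := mk_surjective b
      obtain ⟨h, rfl⟩ := mk_surjective c
      refine mk_eq_iff.2 fun x hx hx' => ?_
      exact map_add f.toFun ⟨g.toFun ⟨x, hx.1.1⟩, hx'.1.2⟩ ⟨h.toFun ⟨x, hx.1.2⟩, hx'.2.2⟩)
    (by
      intro a b c
      obtain ⟨f, rfl⟩ := mk_surjective a
      obtain ⟨g, rfl⟩ := mk_surjective b
      obtain ⟨h, rfl⟩ := mk_surjective c
      exact mk_eq_iff.2 fun x _ _ => rfl)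

/-- Endomorphisms of `M` as everywhere defined partial endomorphisms. -/
def ofEnd : Module.End A M →+* DenseEnd A M where
  toFun φ := mk (DensePMap.ofEnd φ)
  map_one' := rfl
  map_zero' := rfl
  map_mul' _ _ := mk_eq_iff.2 fun _ _ _ => rfl
  map_add' _ _ := mk_eq_iff.2 fun _ _ _ => rfl

end DenseEnd

end DenseEnd

/-! ### Maximal rings of quotients -/

section Max

variable (R : Type u) [Ring R]

/-- The maximal right ring of quotients: classes of right `R`-linear maps `D → R`, `D` a dense
right ideal. -/
abbrev QmaxRight : Type u := DenseEnd Rᵐᵒᵖ R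

/-- The maximal left ring of quotients: classes of left `R`-linear maps `D → R`, `D` a dense
left ideal; maps on a left module are composed in the opposite order. -/
abbrev QmaxLeft : Type u := (DenseEnd R R)ᵐᵒᵖ

/-- `r` is sent to the left multiplication by `r`. -/
def toQmaxRight : R →+* QmaxRight R :=
  DenseEnd.ofEnd.comp (Module.toModuleEnd Rᵐᵒᵖ (S := R) R)

/-- `r` is sent to the right multiplication by `r`. -/
def toQmaxLeft : R →+* QmaxLeft R :=
  (RingHom.op (DenseEnd.ofEnd.comp (Module.toModuleEnd R (S := Rᵐᵒᵖ) R))).comp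
    (RingEquiv.opOp R).toRingHom

variable {R} in
/-- `(f, g)` is a compatible pair: `f(i) j = i g(j)` for `i ∈ dom f` and `j ∈ dom g`. -/
def Compatible (f : DensePMap R R) (g : DensePMap Rᵐᵒᵖ R) : Prop :=
  ∀ (i : f.domain) (j : g.domain), f.toFun i * (j : R) = (i : R) * g.toFun j

/-- The maximal symmetric ring of quotients: classes of compatible pairs `(f, g)`, with `f` defined
on a dense left ideal and `g` on a dense right ideal. -/
def QmaxSymm : Subring (QmaxLeft R × QmaxRight R) where
  carrier := {p | ∃ (f : DensePMap R R) (g : DensePMap Rᵐᵒᵖ R),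
    Compatible f g ∧ p = (op (DenseEnd.mk f), DenseEnd.mk g)}
  mul_mem' := by
    rintro _ _ ⟨f, g, h, rfl⟩ ⟨f', g', h', rfl⟩
    refine ⟨f'.comp f, g.comp g', ?_, rfl⟩
    rintro ⟨i, hi, hi'⟩ ⟨j, hj, hj'⟩
    exact (h' ⟨_, hi'⟩ ⟨j, hj⟩).trans (h ⟨i, hi⟩ ⟨_, hj'⟩)
  one_mem' := ⟨DensePMap.ofEnd LinearMap.id, DensePMap.ofEnd LinearMap.id, fun _ _ => rfl, rfl⟩
  add_mem' := by
    rintro _ _ ⟨f, g, h, rfl⟩ ⟨f', g', h', rfl⟩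
    refine ⟨f.add f', g.add g', ?_, rfl⟩
    rintro ⟨i, hi, hi'⟩ ⟨j, hj, hj'⟩
    have e := h ⟨i, hi⟩ ⟨j, hj⟩
    have e' := h' ⟨i, hi'⟩ ⟨j, hj'⟩
    change (f.toFun ⟨i, hi⟩ + f'.toFun ⟨i, hi'⟩) * j = i * (g.toFun ⟨j, hj⟩ + g'.toFun ⟨j, hj'⟩)
    rw [add_mul, mul_add]
    exact congrArg₂ (· + ·) e e'
  zero_mem' := ⟨DensePMap.ofEnd 0, DensePMap.ofEnd 0,
    fun i j => (zero_mul (j : R)).trans (mul_zero (i : R)).symm, rfl⟩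
  neg_mem' := by
    rintro _ ⟨f, g, h, rfl⟩
    refine ⟨f.neg, g.neg, fun i j => ?_, rfl⟩
    change -(f.toFun i) * (j : R) = (i : R) * -(g.toFun j)
    rw [neg_mul, mul_neg, h i j]

/-- `r` is sent to the pair (right multiplication by `r`, left multiplication by `r`). -/
def toQmaxSymm : R →+* QmaxSymm R :=
  ((toQmaxLeft R).prod (toQmaxRight R)).codRestrict (QmaxSymm R) fun r =>
    ⟨DensePMap.ofEnd (Module.toModuleEnd R (S := Rᵐᵒᵖ) R (op r)),
      DensePMap.ofEnd (Module.toModuleEnd Rᵐᵒᵖ (S := R) R r),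
      fun i j => mul_assoc (i : R) r (j : R), rfl⟩

theorem toQmaxRight_injective : Function.Injective (toQmaxRight R) := by
  intro a b h
  have := DenseEnd.mk_eq_iff.1 h 1 trivial trivial
  change a * 1 = b * 1 at this
  simpa using this

theorem toQmaxLeft_injective : Function.Injective (toQmaxLeft R) := by
  intro a b h
  have := DenseEnd.mk_eq_iff.1 (congrArg unop h) 1 trivial trivial
  change 1 * a = 1 * b at this
  simpa using this

theorem toQmaxSymm_injective : Function.Injective (toQmaxSymm R) := fun _ _ h =>
  toQmaxRight_injective R (congrArg (fun p : QmaxSymm R => p.1.2) h)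

end Max

/-! ### Total rings of quotients -/

section Total

variable {R Q : Type u} [Ring R] [Ring Q]

theorem codRestrict_range_bijective {f : R →+* Q} (hf : Function.Injective f) :
    Function.Bijective (f.codRestrict f.range fun r => ⟨r, rfl⟩) :=
  ⟨fun _ _ h => hf (congrArg Subtype.val h), fun ⟨_, r, hr⟩ => ⟨r, Subtype.ext hr⟩⟩

variable (R)

/-- The total right ring of quotients: the subring of the maximal right ring of quotients generated
by all perfect right rings of quotients of `R` contained in it. This is the union of the latter, as
they form a directed family. -/
def QtotRight : Subring (QmaxRight R) :=
  sSup {S | ∃ h : ∀ r, toQmaxRight R r ∈ S, IsPerfectRight ((toQmaxRight R).codRestrict S h)}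

/-- The total left ring of quotients. -/
def QtotLeft : Subring (QmaxLeft R) :=
  sSup {S | ∃ h : ∀ r, toQmaxLeft R r ∈ S, IsPerfectLeft ((toQmaxLeft R).codRestrict S h)}

/-- The total symmetric ring of quotients: generated by (equivalently, the directed union of) all
perfect symmetric rings of quotients of `R` contained in the maximal symmetric ring of
quotients. -/
def QtotSymm : Subring (QmaxSymm R) :=
  sSup {S | ∃ h : ∀ r, toQmaxSymm R r ∈ S, IsPerfectSymm ((toQmaxSymm R).codRestrict S h)}

/-- The inclusion of `R` in its total right ring of quotients. -/
def toQtotRight : R →+* QtotRight R :=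
  (toQmaxRight R).codRestrict _ fun r =>
    (le_sSup (a := (toQmaxRight R).range) ⟨fun r => ⟨r, rfl⟩,
      isRingEpi_of_surjective (codRestrict_range_bijective (toQmaxRight_injective R)).2,
      makesLeftFlat_of_bijective (codRestrict_range_bijective (toQmaxRight_injective R))⟩ :
        (toQmaxRight R).range ≤ QtotRight R) ⟨r, rfl⟩

/-- The inclusion of `R` in its total left ring of quotients. -/
def toQtotLeft : R →+* QtotLeft R :=
  (toQmaxLeft R).codRestrict _ fun r =>
    (le_sSup (a := (toQmaxLeft R).range) ⟨fun r => ⟨r, rfl⟩,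
      isRingEpi_of_surjective (codRestrict_range_bijective (toQmaxLeft_injective R)).2,
      makesRightFlat_of_bijective (codRestrict_range_bijective (toQmaxLeft_injective R))⟩ :
        (toQmaxLeft R).range ≤ QtotLeft R) ⟨r, rfl⟩

/-- The inclusion of `R` in its total symmetric ring of quotients. -/
def toQtotSymm : R →+* QtotSymm R :=
  (toQmaxSymm R).codRestrict _ fun r =>
    (le_sSup (a := (toQmaxSymm R).range) ⟨fun r => ⟨r, rfl⟩,
      isRingEpi_of_surjective (codRestrict_range_bijective (toQmaxSymm_injective R)).2,
      makesLeftFlat_of_bijective (codRestrict_range_bijective (toQmaxSymm_injective R)),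
      makesRightFlat_of_bijective (codRestrict_range_bijective (toQmaxSymm_injective R))⟩ :
        (toQmaxSymm R).range ≤ QtotSymm R) ⟨r, rfl⟩

end Total

end QuotRing

/-! In a compatible pair `(f, g)` each component determines the other: if `g = 0`, then `f(i) j = i
g(j) = 0` for all `j` in a dense right ideal, so `f(i) = 0`. Hence both projections of the maximal
symmetric ring are injective. They carry a perfect symmetric subring to an isomorphic overring of
`R`, which is therefore perfect on the relevant side. Restricting the projections gives `φ` and `ψ`.

Conversely, let `e` be an isomorphism over `R`. For `x` in the total right ring, bracketing `i x j`
in two ways, with `e` fixing `R`, shows that `(e x, x)` is a compatible pair. This embeds the total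
right ring in the maximal symmetric ring. If the image is a perfect symmetric overring, it lies in
the total symmetric ring, which makes `φ` surjective. Finally `e φ = ψ`, because both sides agree on
`R` and `R` maps epimorphically to the total symmetric ring.

What remains is that the total one-sided rings are themselves perfect. Epimorphisms pass to
generated subrings by looking at equalizers. Flatness goes through an elementwise criterion,
`HasDenominators`: a flat epimorphism satisfies it (`IsPerfectRight.hasDenominators`), an injective
map satisfying it is flat (`HasDenominators.makesLeftFlat`), and it passes to the subring generated
by any family (`hasDenominators_codRestrict_sSup`). No directedness is needed. The left-hand case
follows by passing to opposite rings. -/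

namespace QuotRing

/-! ### Tensor products over a noncommutative ring. -/

section TensorAPI

variable {R : Type u} [Ring R]

namespace NCTensor

variable {M M' N N' : Type u} [AddCommGroup M] [AddCommGroup M'] [AddCommGroup N]
  [AddCommGroup N'] [Module Rᵐᵒᵖ M] [Module Rᵐᵒᵖ M'] [Module R N] [Module R N']

variable (R) in
/-- The class of `m ⊗ n` in `M ⊗_R N`. -/
def tmul (m : M) (n : N) : NCTensor R M N := QuotientAddGroup.mk (m ⊗ₜ[ℤ] n)

theorem tmul_smul (m : M) (r : R) (n : N) : tmul R m (r • n) = tmul R (op r • m) n := by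
  symm
  rw [← sub_eq_zero]
  exact (QuotientAddGroup.eq_zero_iff _).2 (AddSubgroup.subset_closure ⟨m, r, n, rfl⟩)

theorem add_tmul (m m' : M) (n : N) : tmul R (m + m') n = tmul R m n + tmul R m' n := by
  rw [tmul, TensorProduct.add_tmul]; rfl

theorem tmul_add (m : M) (n n' : N) : tmul R m (n + n') = tmul R m n + tmul R m n' := by
  rw [tmul, TensorProduct.tmul_add]; rfl

theorem zero_tmul (n : N) : tmul R (0 : M) n = 0 := by
  rw [tmul, TensorProduct.zero_tmul]; rfl

theorem tmul_zero (m : M) : tmul R m (0 : N) = 0 := by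
  rw [tmul, TensorProduct.tmul_zero]; rfl

theorem map_tmul (φ : M →ₗ[Rᵐᵒᵖ] M') (ψ : N →ₗ[R] N') (m : M) (n : N) :
    map φ ψ (tmul R m n) = tmul R (φ m) (ψ n) := rfl

theorem induction_on {p : NCTensor R M N → Prop} (t : NCTensor R M N) (zero : p 0)
    (tmul : ∀ m n, p (tmul R m n)) (add : ∀ a b, p a → p b → p (a + b)) : p t := by
  obtain ⟨t, rfl⟩ := QuotientAddGroup.mk_surjective t
  refine TensorProduct.induction_on (motive := fun t => p (QuotientAddGroup.mk t)) t zero tmul ?_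
  exact fun a b ha hb => add _ _ ha hb

theorem addHom_ext {P : Type*} [AddCommGroup P] {a b : NCTensor R M N →+ P}
    (h : ∀ m n, a (tmul R m n) = b (tmul R m n)) : a = b := by
  refine AddMonoidHom.ext fun t => ?_
  induction t using NCTensor.induction_on with
  | zero => simp
  | tmul m n => exact h m n
  | add x y hx hy => rw [map_add, map_add, hx, hy]

/-- The additive map out of `M ⊗_R N` given by a balanced biadditive map. -/
def lift {P : Type*} [AddCommGroup P] (b : M →+ N →+ P)
    (hb : ∀ m (r : R) n, b (op r • m) n = b m (r • n)) : NCTensor R M N →+ P :=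
  QuotientAddGroup.lift _
    (TensorProduct.liftAddHom b fun z m n => by
      rw [map_zsmul, map_zsmul, AddMonoidHom.smul_apply]) <| by
    refine (AddSubgroup.closure_le _).2 ?_
    rintro _ ⟨m, r, n, rfl⟩
    exact (map_sub _ _ _).trans (sub_eq_zero.2 (hb m r n))

theorem map_comp_apply {M'' N'' : Type u} [AddCommGroup M''] [AddCommGroup N'']
    [Module Rᵐᵒᵖ M''] [Module R N''] (φ : M →ₗ[Rᵐᵒᵖ] M') (ψ : N →ₗ[R] N')
    (φ' : M' →ₗ[Rᵐᵒᵖ] M'') (ψ' : N' →ₗ[R] N'') (t : NCTensor R M N) :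
    map φ' ψ' (map φ ψ t) = map (φ' ∘ₗ φ) (ψ' ∘ₗ ψ) t := by
  have : (map φ' ψ').comp (map φ ψ) = map (φ' ∘ₗ φ) (ψ' ∘ₗ ψ) := addHom_ext fun _ _ => rfl
  exact DFunLike.congr_fun this t

theorem map_id_apply (t : NCTensor R M N) :
    map (LinearMap.id : M →ₗ[Rᵐᵒᵖ] M) (LinearMap.id : N →ₗ[R] N) t = t := by
  have : map (LinearMap.id : M →ₗ[Rᵐᵒᵖ] M) (LinearMap.id : N →ₗ[R] N) = AddMonoidHom.id _ :=
    addHom_ext fun _ _ => rfl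
  exact DFunLike.congr_fun this t

theorem map_add_right (φ : M →ₗ[Rᵐᵒᵖ] M') (ψ ψ' : N →ₗ[R] N') (t : NCTensor R M N) :
    map φ (ψ + ψ') t = map φ ψ t + map φ ψ' t := by
  have : map φ (ψ + ψ') = map φ ψ + map φ ψ' := addHom_ext fun m n => tmul_add _ _ _
  exact DFunLike.congr_fun this t

theorem map_zero_right (φ : M →ₗ[Rᵐᵒᵖ] M') (t : NCTensor R M N) :
    map φ (0 : N →ₗ[R] N') t = 0 := by
  have : map φ (0 : N →ₗ[R] N') = 0 := addHom_ext fun m n => tmul_zero _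
  exact DFunLike.congr_fun this t

end NCTensor

end TensorAPI

/-! ### Flat epimorphisms and denominators. -/

section Criterion

variable {R S : Type u} [Ring R] [Ring S]

/-- Every `s : S` has denominators in `R`: the right ideal `{r | s * f r ∈ f R}` of `R` generates
the unit right ideal of `S`. -/
def HasDenominators (f : R →+* S) : Prop :=
  ∀ s : S, (1 : S) ∈ Submodule.span Sᵐᵒᵖ (f '' {r | s * f r ∈ f.range})

/-- A map between left `S`-modules linear over the source of a ring epimorphism is `S`-linear. -/
theorem IsRingEpi.map_smul {f : R →+* S} (hf : IsRingEpi f) {X Y : Type u} [AddCommGroup X]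
    [AddCommGroup Y] (a : S →+* AddMonoid.End X) (b : S →+* AddMonoid.End Y) (δ : X →+ Y)
    (h : ∀ r x, δ (a (f r) x) = b (f r) (δ x)) (s : S) (x : X) : δ (a s x) = b s (δ x) := by
  let g : S →+* AddMonoid.End (X × Y) :=
    { toFun := fun s => (a s).prodMap (b s)
      map_one' := AddMonoidHom.ext fun p =>
        Prod.ext (DFunLike.congr_fun (map_one a) p.1) (DFunLike.congr_fun (map_one b) p.2)
      map_mul' := fun s t => AddMonoidHom.ext fun p =>
        Prod.ext (DFunLike.congr_fun (map_mul a s t) p.1) (DFunLike.congr_fun (map_mul b s t) p.2)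
      map_zero' := AddMonoidHom.ext fun p =>
        Prod.ext (DFunLike.congr_fun (map_zero a) p.1) (DFunLike.congr_fun (map_zero b) p.2)
      map_add' := fun s t => AddMonoidHom.ext fun p =>
        Prod.ext (DFunLike.congr_fun (map_add a s t) p.1)
          (DFunLike.congr_fun (map_add b s t) p.2) }
  -- `D (x, y) = (0, δ x)` has square zero, so `1 + D` is invertible with inverse `1 - D`.
  -- Conjugating the diagonal action `g` by `1 + D` leaves it unchanged exactly where `D` commutes
  -- with it. This holds over `R`, hence over `S` by the epimorphism property.
  let D : AddMonoid.End (X × Y) := (AddMonoidHom.inr X Y).comp (δ.comp (AddMonoidHom.fst X Y))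
  have hD : D * D = 0 := AddMonoidHom.ext fun p => Prod.ext rfl (map_zero δ)
  have hUV : (1 + D) * (1 - D) = 1 := by
    rw [add_mul, mul_sub, mul_sub, hD]; simp
  have hVU : (1 - D) * (1 + D) = 1 := by
    rw [sub_mul, mul_add, mul_add, hD]; simp
  let g' : S →+* AddMonoid.End (X × Y) :=
    { toFun := fun s => (1 + D) * g s * (1 - D)
      map_one' := by rw [map_one, mul_one, hUV]
      map_mul' := fun s t => by
        calc (1 + D) * g (s * t) * (1 - D)
            = (1 + D) * g s * ((1 - D) * (1 + D)) * (g t * (1 - D)) := by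
              rw [hVU, mul_one, map_mul]; simp only [mul_assoc]
          _ = _ := by simp only [mul_assoc]
      map_zero' := by simp
      map_add' := fun s t => by rw [map_add, mul_add, add_mul] }
  have key : g = g' := hf _ g g' <| RingHom.ext fun r => by
    have : D * g (f r) = g (f r) * D :=
      AddMonoidHom.ext fun p => Prod.ext (map_zero (a (f r))).symm (h r p.1)
    change g (f r) = (1 + D) * g (f r) * (1 - D)
    rw [add_mul, this, one_mul, ← mul_one_add, mul_assoc, hUV, mul_one]
  have key' : g s * (1 + D) = (1 + D) * g s := by
    conv_lhs => rw [key]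
    change (1 + D) * g s * (1 - D) * (1 + D) = _
    rw [mul_assoc, hVU, mul_one]
  rw [mul_one_add, one_add_mul] at key'
  exact (congrArg Prod.snd (DFunLike.congr_fun (add_left_cancel key') (x, 0))).symm

/-- The map `x ↦ 1 ⊗ x` from `S` to `S ⊗_R S` is `R`-linear for the action on the first factor,
hence `S`-linear by `IsRingEpi.map_smul`. -/
theorem IsRingEpi.tmul_eq {f : R →+* S} (hf : IsRingEpi f) [Module R S] [Module Rᵐᵒᵖ S]
    (hl : ∀ (r : R) (s : S), r • s = f r * s) (hr : ∀ (r : R) (s : S), op r • s = s * f r)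
    (s x : S) : NCTensor.tmul R s x = NCTensor.tmul R 1 (s * x) := by
  let m : S → S →ₗ[Rᵐᵒᵖ] S := fun s =>
    { toFun := fun x => s * x
      map_add' := mul_add s
      map_smul' := fun r x => by
        obtain ⟨r, rfl⟩ := op_surjective r; simp [hr, mul_assoc] }
  let b : S →+* AddMonoid.End (NCTensor R S S) :=
    { toFun := fun s => NCTensor.map (m s) LinearMap.id
      map_one' := NCTensor.addHom_ext fun x y => by
        rw [NCTensor.map_tmul]; exact congrArg (NCTensor.tmul R · y) (one_mul x)
      map_mul' := fun s t => NCTensor.addHom_ext fun x y => by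
        rw [NCTensor.map_tmul]; exact congrArg (NCTensor.tmul R · y) (mul_assoc s t x)
      map_zero' := NCTensor.addHom_ext fun x y => by
        rw [NCTensor.map_tmul]
        exact (congrArg (NCTensor.tmul R · y) (zero_mul x)).trans (NCTensor.zero_tmul y)
      map_add' := fun s t => NCTensor.addHom_ext fun x y => by
        rw [NCTensor.map_tmul]
        exact (congrArg (NCTensor.tmul R · y) (add_mul s t x)).trans (NCTensor.add_tmul _ _ y) }
  have := hf.map_smul (Module.toAddMonoidEnd S S) b
    (AddMonoidHom.mk' (fun x => NCTensor.tmul R 1 x) fun x y => NCTensor.tmul_add 1 x y)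
    (fun r x => by
      change NCTensor.tmul R 1 (f r * x) = NCTensor.tmul R (f r * 1) x
      rw [← hl, NCTensor.tmul_smul, hr, one_mul, mul_one]) s x
  change NCTensor.tmul R 1 (s * x) = NCTensor.tmul R (s * 1) x at this
  rw [this, mul_one]

/-- With `J` the right ideal of denominators of `s`, multiplication by `s` embeds `R/J` in `S/f(R)`.
By flatness this stays injective after tensoring with `S`. There `1 ⊗ 1` goes to `s ⊗ 1 = 1 ⊗ s`,
which is zero as `1 ∈ f(R)`. So `1 ⊗ 1` vanishes in `(R/J) ⊗_R S`, and its image `1` in `S/JS` is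
zero. -/
theorem IsPerfectRight.hasDenominators {f : R →+* S} (hf : IsPerfectRight f) :
    HasDenominators f := by
  intro s
  let _ : Module R S := Module.compHom S f
  let _ : Module Rᵐᵒᵖ S := Module.compHom S (RingHom.op f)
  have hl : ∀ (r : R) (s : S), r • s = f r * s := fun _ _ => rfl
  have hr : ∀ (r : R) (s : S), op r • s = s * f r := fun _ _ => rfl
  let F : R →ₗ[Rᵐᵒᵖ] S :=
    { toFun := f
      map_add' := map_add f
      map_smul' := fun r x => by obtain ⟨r, rfl⟩ := op_surjective r; simp [hr] }
  let mS : R →ₗ[Rᵐᵒᵖ] S :=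
    { toFun := fun r => s * f r
      map_add' := fun x y => by rw [map_add, mul_add]
      map_smul' := fun r x => by obtain ⟨r, rfl⟩ := op_surjective r; simp [hr, mul_assoc] }
  let B : Submodule Rᵐᵒᵖ S := LinearMap.range F
  let J : Submodule Rᵐᵒᵖ R := B.comap mS
  have memJ : ∀ r, r ∈ J ↔ r ∈ {r | s * f r ∈ f.range} := fun r => Iff.rfl
  let φ : (R ⧸ J) →ₗ[Rᵐᵒᵖ] (S ⧸ B) := J.mapQ B mS le_rfl
  have hφ : Function.Injective φ := by
    rw [injective_iff_map_eq_zero]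
    intro x hx
    obtain ⟨x, rfl⟩ := Submodule.Quotient.mk_surjective J x
    exact (Submodule.Quotient.mk_eq_zero J).2 ((Submodule.Quotient.mk_eq_zero B).1 hx)
  let K : Submodule Sᵐᵒᵖ S := Submodule.span Sᵐᵒᵖ (f '' {r | s * f r ∈ f.range})
  let β : (R ⧸ J) →+ S →+ S ⧸ K :=
    QuotientAddGroup.lift J.toAddSubgroup
      (AddMonoidHom.mk' (fun r => AddMonoidHom.mk'
        (fun x => (Submodule.Quotient.mk (f r * x) : S ⧸ K))
        fun x y => by rw [mul_add]; rfl) fun r r' => by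
          ext x
          change (Submodule.Quotient.mk _ : S ⧸ K) = _
          rw [map_add, add_mul]; rfl) <| by
      intro r hr
      ext x
      refine (Submodule.Quotient.mk_eq_zero K).2 ?_
      exact K.smul_mem (op x) (Submodule.subset_span ⟨r, hr, rfl⟩)
  -- The canonical map `(R/J) ⊗_R S → S/JS`, where `K = JS`.
  let c : NCTensor R (R ⧸ J) S →+ S ⧸ K := NCTensor.lift β fun m r x => by
    obtain ⟨m, rfl⟩ := Submodule.Quotient.mk_surjective J m
    change (Submodule.Quotient.mk (f (m * r) * x) : S ⧸ K) = Submodule.Quotient.mk (f m * (f r * x))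
    rw [map_mul, mul_assoc]
  have zero : NCTensor.tmul R (Submodule.Quotient.mk 1 : R ⧸ J) (1 : S) = 0 := by
    apply hf.2 _ _ φ hφ
    rw [map_zero, NCTensor.map_tmul]
    have e := congrArg (NCTensor.map B.mkQ LinearMap.id) (hf.1.tmul_eq hl hr s 1)
    rw [NCTensor.map_tmul, NCTensor.map_tmul] at e
    have h1 : B.mkQ 1 = 0 := (Submodule.Quotient.mk_eq_zero B).2 ⟨1, map_one f⟩
    have h2 : φ (Submodule.Quotient.mk 1) = B.mkQ s := by
      change (Submodule.Quotient.mk (s * f 1) : S ⧸ B) = _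
      rw [map_one, mul_one]; rfl
    rw [h2]
    refine e.trans ?_
    rw [h1, NCTensor.zero_tmul]
  have := congrArg c zero
  rw [map_zero] at this
  change (Submodule.Quotient.mk (f 1 * 1) : S ⧸ K) = 0 at this
  rw [map_one, mul_one] at this
  exact (Submodule.Quotient.mk_eq_zero K).1 this

/-- The common denominators of a finite set. -/
def commonDenominators (f : R →+* S) (E : Finset S) : Set R := {r | ∀ s ∈ E, s * f r ∈ f.range}

/-- Transitivity of generating the unit ideal: `f r = f r * 1` lies in the span of the `f (r * x)`,
so the span of `f '' P'` contains that of `f '' P`. -/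
theorem one_mem_span_image_of_forall {f : R →+* S} {P P' : Set R}
    (h : (1 : S) ∈ Submodule.span Sᵐᵒᵖ (f '' P))
    (h' : ∀ r ∈ P, (1 : S) ∈ Submodule.span Sᵐᵒᵖ (f '' {x | r * x ∈ P'})) :
    (1 : S) ∈ Submodule.span Sᵐᵒᵖ (f '' P') := by
  refine Submodule.span_le.2 ?_ h
  rintro _ ⟨r, hr, rfl⟩
  have h := Submodule.mem_map_of_mem (f := LinearMap.mulLeft Sᵐᵒᵖ (f r)) (h' r hr)
  rw [LinearMap.mulLeft_apply, mul_one, Submodule.map_span] at h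
  refine Submodule.span_mono ?_ h
  rintro _ ⟨_, ⟨x, hx, rfl⟩, rfl⟩
  exact ⟨r * x, hx, map_mul f r x⟩

/-- If `r` serves `E` and `x` is a denominator of `s * f r`, then `r * x` serves both `E` and `s`.
-/
theorem HasDenominators.one_mem_span {f : R →+* S} (hf : HasDenominators f) (E : Finset S) :
    (1 : S) ∈ Submodule.span Sᵐᵒᵖ (f '' commonDenominators f E) := by
  classical
  induction E using Finset.induction_on with
  | empty => exact Submodule.subset_span ⟨1, by simp [commonDenominators], map_one f⟩
  | insert s E _ ih =>
    refine one_mem_span_image_of_forall ih fun r hr =>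
      Submodule.span_mono (Set.image_mono fun x hx t ht => ?_) (hf (s * f r))
    rw [map_mul, ← mul_assoc]
    rcases Finset.mem_insert.1 ht with rfl | ht
    · exact hx
    · exact mul_mem (hr t ht) ⟨x, rfl⟩

variable (R) in
/-- The functions `R → M` that vanish on the common denominators of some finite set. -/
def vanishing (f : R →+* S) (M : Type u) [AddCommGroup M] : AddSubgroup (R → M) where
  carrier := {h | ∃ E : Finset S, ∀ r ∈ commonDenominators f E, h r = 0}
  zero_mem' := ⟨∅, fun _ _ => rfl⟩
  add_mem' := by
    classical
    rintro a b ⟨E, hE⟩ ⟨E', hE'⟩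
    refine ⟨E ∪ E', fun r hr => ?_⟩
    rw [Pi.add_apply, hE r fun s hs => hr s (Finset.mem_union_left _ hs),
      hE' r fun s hs => hr s (Finset.mem_union_right _ hs), add_zero]
  neg_mem' := by
    rintro a ⟨E, hE⟩
    exact ⟨E, fun r hr => by rw [Pi.neg_apply, hE r hr, neg_zero]⟩

variable {M : Type u} [AddCommGroup M] [Module Rᵐᵒᵖ M]

open Classical in
/-- The function `r ↦ m (s r)` on the denominators `r` of `s`, extended by zero. -/
noncomputable def denomMap (f : R →+* S) (m : M) (s : S) (r : R) : M :=
  if h : ∃ y, f y = s * f r then op h.choose • m else 0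

/-- Injectivity of `f` makes the numerator `y` unique, so the choice in `denomMap` is harmless. -/
theorem denomMap_apply {f : R →+* S} (hf : Function.Injective f) (m : M) {s : S} {r y : R}
    (h : f y = s * f r) : denomMap f m s r = op y • m := by
  have h' : ∃ y, f y = s * f r := ⟨y, h⟩
  rw [denomMap, dif_pos h', hf (h'.choose_spec.trans h.symm)]

theorem mk_eq_mk_of_commonDenominators {M : Type u} [AddCommGroup M] {f : R →+* S}
    (E : Finset S) {a b : R → M}
    (h : ∀ r ∈ commonDenominators f E, a r = b r) :
    (QuotientAddGroup.mk a : (R → M) ⧸ vanishing R f M) = QuotientAddGroup.mk b := by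
  rw [← sub_eq_zero, ← QuotientAddGroup.mk_sub, QuotientAddGroup.eq_zero_iff]
  exact ⟨E, fun r hr => sub_eq_zero.2 (h r hr)⟩

/-- The map from `M ⊗_R S` to germs of functions `R → M` sending `m ⊗ s` to `r ↦ m (s r)`. -/
noncomputable def tensorToGerm {f : R →+* S} (hf : Function.Injective f) [Module R S]
    (hl : ∀ (r : R) (s : S), r • s = f r * s) (M : Type u) [AddCommGroup M] [Module Rᵐᵒᵖ M] :
    NCTensor R M S →+ (R → M) ⧸ vanishing R f M :=
  NCTensor.lift
    (AddMonoidHom.mk' (fun m => AddMonoidHom.mk' (fun s => QuotientAddGroup.mk (denomMap f m s))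
      fun s t => by
        classical
        refine mk_eq_mk_of_commonDenominators {s, t} fun r hr => ?_
        obtain ⟨x, hx⟩ := hr s (by simp)
        obtain ⟨y, hy⟩ := hr t (by simp)
        rw [denomMap_apply hf m (y := x + y) (by rw [map_add, hx, hy, add_mul]), op_add, add_smul,
          ← denomMap_apply hf m hx, ← denomMap_apply hf m hy]
        rfl)
      fun m m' => AddMonoidHom.ext fun s => mk_eq_mk_of_commonDenominators {s} fun r hr => by
        obtain ⟨x, hx⟩ := hr s (by simp)
        rw [denomMap_apply hf _ hx, smul_add, ← denomMap_apply hf m hx, ← denomMap_apply hf m' hx]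
        rfl)
    fun m r s => mk_eq_mk_of_commonDenominators {s} fun x hx => by
      obtain ⟨y, hy⟩ := hx s (by simp)
      rw [denomMap_apply hf _ hy,
        denomMap_apply hf m (y := r * y) (by rw [map_mul, hy, hl, mul_assoc]), op_mul, mul_smul]

/-- A common denominator `r` of the second factors clears them: `m ⊗ s (f r) q = m ⊗ (f y) q = m y ⊗
q`. The free factor `q` lets the annihilating elements form a right ideal of `S` later on. -/
theorem exists_tensorToGerm_eq {f : R →+* S} (hf : Function.Injective f) [Module R S]
    [IsScalarTower R S S] (hl : ∀ (r : R) (s : S), r • s = f r * s) (t : NCTensor R M S) :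
    ∃ (h : R → M) (E : Finset S), tensorToGerm hf hl M t = QuotientAddGroup.mk h ∧
      ∀ r ∈ commonDenominators f E, ∀ q : S,
        NCTensor.map LinearMap.id (LinearMap.mulRight R (f r * q)) t = NCTensor.tmul R (h r) q := by
  classical
  induction t using NCTensor.induction_on with
  | zero => exact ⟨0, ∅, map_zero _, fun r _ q => by
    rw [map_zero, Pi.zero_apply, NCTensor.zero_tmul]⟩
  | tmul m s =>
    refine ⟨denomMap f m s, {s}, rfl, fun r hr q => ?_⟩
    obtain ⟨y, hy⟩ := hr s (by simp)
    rw [NCTensor.map_tmul, denomMap_apply hf m hy, ← NCTensor.tmul_smul, hl, hy, mul_assoc]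
    rfl
  | add a b ha hb =>
    obtain ⟨h, E, e, he⟩ := ha
    obtain ⟨h', E', e', he'⟩ := hb
    refine ⟨h + h', E ∪ E', by rw [map_add, e, e']; rfl, fun r hr q => ?_⟩
    rw [map_add, he r fun s hs => hr s (Finset.mem_union_left _ hs),
      he' r fun s hs => hr s (Finset.mem_union_right _ hs), Pi.add_apply, NCTensor.add_tmul]

/-- If the germ of `t` vanishes, then `t` is killed by `f r` for all common denominators `r` of a
finite set. These generate the unit right ideal, so `t = t * 1 = 0`. -/
theorem HasDenominators.tensorToGerm_injective {f : R →+* S} (hd : HasDenominators f)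
    (hf : Function.Injective f) [Module R S]
    [IsScalarTower R S S] (hl : ∀ (r : R) (s : S), r • s = f r * s) :
    Function.Injective (tensorToGerm hf hl M) := by
  classical
  rw [injective_iff_map_eq_zero]
  intro t ht
  obtain ⟨h, E, e, he⟩ := exists_tensorToGerm_eq hf hl t
  rw [ht, eq_comm, QuotientAddGroup.eq_zero_iff] at e
  obtain ⟨E', hE'⟩ := e
  let A : Submodule Sᵐᵒᵖ S :=
    { carrier := {s | ∀ q, NCTensor.map LinearMap.id (LinearMap.mulRight R (s * q)) t = 0}
      zero_mem' := fun q => by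
        rw [zero_mul, show LinearMap.mulRight R (0 : S) = 0 by ext; simp, NCTensor.map_zero_right]
      add_mem' := fun {a b} ha hb q => by
        have : LinearMap.mulRight R ((a + b) * q) =
            LinearMap.mulRight R (a * q) + LinearMap.mulRight R (b * q) := by
          ext x; simp [add_mul, mul_add, mul_assoc]
        rw [this, NCTensor.map_add_right, ha, hb, add_zero]
      smul_mem' := fun s x hx q => by
        obtain ⟨s, rfl⟩ := op_surjective s
        rw [op_smul_eq_mul, mul_assoc]; exact hx _ }
  have h1 : (1 : S) ∈ A := by
    refine Submodule.span_le.2 ?_ (hd.one_mem_span (E ∪ E'))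
    rintro _ ⟨r, hr, rfl⟩ q
    rw [he r fun s hs => hr s (Finset.mem_union_left _ hs),
      hE' r fun s hs => hr s (Finset.mem_union_right _ hs), NCTensor.zero_tmul]
  have := h1 1
  rw [mul_one, LinearMap.mulRight_one] at this
  rwa [NCTensor.map_id_apply] at this

/-- `M ⊗_R S` embeds, naturally in `M`, in germs of functions `R → M`, and an injective `φ` stays
injective on germs. -/
theorem HasDenominators.makesLeftFlat {f : R →+* S} (hd : HasDenominators f)
    (hf : Function.Injective f) : MakesLeftFlat f := by
  let _ : Module R S := Module.compHom S f
  have : IsScalarTower R S S := ⟨fun r s t => mul_assoc (f r) s t⟩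
  have hl : ∀ (r : R) (s : S), r • s = f r * s := fun _ _ => rfl
  intro M M' _ _ _ _ φ hφ
  rw [injective_iff_map_eq_zero]
  intro t ht
  apply hd.tensorToGerm_injective hf hl
  let G : (R → M) ⧸ vanishing R f M →+ (R → M') ⧸ vanishing R f M' :=
    QuotientAddGroup.map _ _ (φ.toAddMonoidHom.compLeft R) <| by
      rintro h ⟨E, hE⟩
      exact ⟨E, fun r hr => (congrArg φ (hE r hr)).trans (map_zero φ)⟩
  have nat : (tensorToGerm hf hl M').comp (NCTensor.map φ LinearMap.id) =
      G.comp (tensorToGerm hf hl M) := NCTensor.addHom_ext fun m s =>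
    mk_eq_mk_of_commonDenominators {s} fun r hr => by
      obtain ⟨y, hy⟩ := hr s (by simp)
      change denomMap f (φ m) s r = φ (denomMap f m s r)
      rw [denomMap_apply hf _ hy, denomMap_apply hf _ hy, map_smul]
  obtain ⟨h, -, e, -⟩ := exists_tensorToGerm_eq hf hl t
  have e' := DFunLike.congr_fun nat t
  change tensorToGerm hf hl M' (NCTensor.map φ LinearMap.id t) = G (tensorToGerm hf hl M t) at e'
  rw [ht, map_zero, e, eq_comm, QuotientAddGroup.map_mk, QuotientAddGroup.eq_zero_iff] at e'
  obtain ⟨E, hE⟩ := e'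
  rw [e, map_zero, QuotientAddGroup.eq_zero_iff]
  exact ⟨E, fun r hr => hφ ((hE r hr).trans (map_zero φ).symm)⟩

end Criterion
-- Transport along isomorphisms and to opposite rings.
section Transport

variable {R S S' : Type u} [Ring R] [Ring S] [Ring S']

theorem FlatLeftModule.of_equiv {N N' : Type u} [AddCommGroup N] [AddCommGroup N'] [Module R N]
    [Module R N'] (h : FlatLeftModule R N) (e : N ≃ₗ[R] N') : FlatLeftModule R N' := by
  intro M M' _ _ _ _ φ hφ a b hab
  have := congrArg (NCTensor.map LinearMap.id e.symm.toLinearMap) hab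
  rw [NCTensor.map_comp_apply, NCTensor.map_comp_apply] at this
  have key : ∀ t : NCTensor R M N', NCTensor.map (LinearMap.id ∘ₗ φ)
      (e.symm.toLinearMap ∘ₗ LinearMap.id) t = NCTensor.map φ LinearMap.id
        (NCTensor.map LinearMap.id e.symm.toLinearMap t) := fun t => by
    rw [NCTensor.map_comp_apply]; rfl
  rw [key, key] at this
  have := congrArg (NCTensor.map LinearMap.id e.toLinearMap) (h M M' φ hφ this)
  rw [NCTensor.map_comp_apply, NCTensor.map_comp_apply] at this
  have hid : e.toLinearMap ∘ₗ e.symm.toLinearMap = LinearMap.id := by ext; simp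
  rwa [hid, LinearMap.id_comp, NCTensor.map_id_apply, NCTensor.map_id_apply] at this

theorem MakesLeftFlat.of_equiv {f : R →+* S} (h : MakesLeftFlat f) (e : S ≃+* S') {f' : R →+* S'}
    (he : ∀ r, e (f r) = f' r) : MakesLeftFlat f' := by
  let _ : Module R S := Module.compHom S f
  let _ : Module R S' := Module.compHom S' f'
  exact FlatLeftModule.of_equiv (N := S) h
    { e.toAddEquiv with
      map_smul' := fun r s => by
        change e (f r * s) = f' r * e s
        rw [map_mul, he] }

theorem IsRingEpi.of_equiv {f : R →+* S} (h : IsRingEpi f) (e : S ≃+* S') {f' : R →+* S'}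
    (he : ∀ r, e (f r) = f' r) : IsRingEpi f' := by
  intro T _ a b hab
  have := h T (a.comp e.toRingHom) (b.comp e.toRingHom) <| RingHom.ext fun r => by
    change a (e (f r)) = b (e (f r))
    rw [he]; exact DFunLike.congr_fun hab r
  ext s
  obtain ⟨s, rfl⟩ := e.surjective s
  exact DFunLike.congr_fun this s

theorem IsRingEpi.op {f : R →+* S} (h : IsRingEpi f) : IsRingEpi (RingHom.op f) := by
  intro T _ a b hab
  have := h Tᵐᵒᵖ (RingHom.unop ((RingEquiv.opOp T).toRingHom.comp a))
    (RingHom.unop ((RingEquiv.opOp T).toRingHom.comp b)) <| RingHom.ext fun r =>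
      congrArg MulOpposite.op (DFunLike.congr_fun hab (MulOpposite.op r))
  ext s
  exact congrArg unop (DFunLike.congr_fun this (unop s))

variable (R) in
/-- The map `M ⊗_R N → N ⊗_{Rᵐᵒᵖ} M` swapping the factors. -/
def NCTensor.swap (M N : Type u) [AddCommGroup M] [AddCommGroup N] [Module Rᵐᵒᵖ M] [Module R N]
    [Module Rᵐᵒᵖᵐᵒᵖ N] (hN : ∀ (r : R) (n : N), op (op r) • n = r • n) :
    NCTensor R M N →+ NCTensor Rᵐᵒᵖ N M :=
  NCTensor.lift
    (AddMonoidHom.mk' (fun m => AddMonoidHom.mk' (fun n => NCTensor.tmul Rᵐᵒᵖ n m)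
      fun n n' => NCTensor.add_tmul n n' m) fun m m' => AddMonoidHom.ext fun n =>
        NCTensor.tmul_add n m m')
    fun m r n => by
      change NCTensor.tmul Rᵐᵒᵖ n (op r • m) = NCTensor.tmul Rᵐᵒᵖ (r • n) m
      rw [NCTensor.tmul_smul, hN]

variable (R) in
/-- The inverse of `NCTensor.swap`. -/
def NCTensor.swapInv (M N : Type u) [AddCommGroup M] [AddCommGroup N] [Module Rᵐᵒᵖ M] [Module R N]
    [Module Rᵐᵒᵖᵐᵒᵖ N] (hN : ∀ (r : R) (n : N), op (op r) • n = r • n) :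
    NCTensor Rᵐᵒᵖ N M →+ NCTensor R M N :=
  NCTensor.lift
    (AddMonoidHom.mk' (fun n => AddMonoidHom.mk' (fun m => NCTensor.tmul R m n)
      fun m m' => NCTensor.add_tmul m m' n) fun n n' => AddMonoidHom.ext fun m =>
        NCTensor.tmul_add m n n')
    fun n r m => by
      obtain ⟨r, rfl⟩ := op_surjective r
      change NCTensor.tmul R m (op (op r) • n) = NCTensor.tmul R (op r • m) n
      rw [← NCTensor.tmul_smul, hN]

section

variable {M N : Type u} [AddCommGroup M] [AddCommGroup N] [Module Rᵐᵒᵖ M] [Module R N]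
    [Module Rᵐᵒᵖᵐᵒᵖ N] (hN : ∀ (r : R) (n : N), op (op r) • n = r • n)

theorem NCTensor.swap_injective : Function.Injective (NCTensor.swap R M N hN) := by
  have : (swapInv R M N hN).comp (swap R M N hN) = AddMonoidHom.id _ := addHom_ext fun _ _ => rfl
  exact Function.LeftInverse.injective (DFunLike.congr_fun this)

theorem NCTensor.swapInv_injective : Function.Injective (NCTensor.swapInv R M N hN) := by
  have : (swap R M N hN).comp (swapInv R M N hN) = AddMonoidHom.id _ := addHom_ext fun _ _ => rfl
  exact Function.LeftInverse.injective (DFunLike.congr_fun this)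

end

/-- Swapping the factors turns one tensor functor into the other, once left `R`-modules are
identified with left modules over the double opposite. -/
theorem flatRightModule_iff_flatLeftModule_op {M : Type u} [AddCommGroup M] [Module Rᵐᵒᵖ M] :
    FlatRightModule R M ↔ FlatLeftModule Rᵐᵒᵖ M := by
  constructor
  · intro h N N' _ _ _ _ ψ hψ
    let _ : Module R N := Module.compHom N (RingEquiv.opOp R).toRingHom
    let _ : Module R N' := Module.compHom N' (RingEquiv.opOp R).toRingHom
    have hN : ∀ (r : R) (n : N), op (op r) • n = r • n := fun _ _ => rfl
    have hN' : ∀ (r : R) (n : N'), op (op r) • n = r • n := fun _ _ => rfl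
    let ψ' : N →ₗ[R] N' := { ψ with map_smul' := fun r n => ψ.map_smul (op (op r)) n }
    have key : (NCTensor.swapInv R M N' hN').comp (NCTensor.map ψ LinearMap.id) =
        (NCTensor.map LinearMap.id ψ').comp (NCTensor.swapInv R M N hN) :=
      NCTensor.addHom_ext fun _ _ => rfl
    have inj := (h N N' ψ' hψ).comp (NCTensor.swapInv_injective (M := M) hN)
    rw [← AddMonoidHom.coe_comp, ← key, AddMonoidHom.coe_comp] at inj
    exact inj.of_comp
  · intro h N N' _ _ _ _ ψ hψ
    let _ : Module Rᵐᵒᵖᵐᵒᵖ N := Module.compHom N (RingEquiv.opOp R).symm.toRingHom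
    let _ : Module Rᵐᵒᵖᵐᵒᵖ N' := Module.compHom N' (RingEquiv.opOp R).symm.toRingHom
    have hN : ∀ (r : R) (n : N), op (op r) • n = r • n := fun _ _ => rfl
    have hN' : ∀ (r : R) (n : N'), op (op r) • n = r • n := fun _ _ => rfl
    let ψ' : N →ₗ[Rᵐᵒᵖᵐᵒᵖ] N' := { ψ with map_smul' := fun r n => ψ.map_smul (unop (unop r)) n }
    have key : (NCTensor.swap R M N' hN').comp (NCTensor.map LinearMap.id ψ) =
        (NCTensor.map ψ' LinearMap.id).comp (NCTensor.swap R M N hN) :=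
      NCTensor.addHom_ext fun _ _ => rfl
    have inj := (h N N' ψ' hψ).comp (NCTensor.swap_injective (M := M) hN)
    rw [← AddMonoidHom.coe_comp, ← key, AddMonoidHom.coe_comp] at inj
    exact inj.of_comp

theorem makesRightFlat_iff_makesLeftFlat_op {f : R →+* S} :
    MakesRightFlat f ↔ MakesLeftFlat (RingHom.op f) := by
  let _ : Module Rᵐᵒᵖ S := Module.compHom S (RingHom.op f)
  let _ : Module Rᵐᵒᵖ Sᵐᵒᵖ := Module.compHom Sᵐᵒᵖ (RingHom.op f)
  let e : S ≃ₗ[Rᵐᵒᵖ] Sᵐᵒᵖ := { opAddEquiv with map_smul' := fun _ _ => rfl }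
  refine flatRightModule_iff_flatLeftModule_op.trans ⟨fun h => ?_, fun h => ?_⟩
  · exact FlatLeftModule.of_equiv h e
  · exact FlatLeftModule.of_equiv h e.symm

theorem MakesRightFlat.of_equiv {f : R →+* S} (h : MakesRightFlat f) (e : S ≃+* S')
    {f' : R →+* S'} (he : ∀ r, e (f r) = f' r) : MakesRightFlat f' :=
  makesRightFlat_iff_makesLeftFlat_op.2 <|
    (makesRightFlat_iff_makesLeftFlat_op.1 h).of_equiv (RingEquiv.op e) fun r =>
      congrArg op (he (unop r))

end Transport

/-! ### Perfect overrings are closed under generated subrings. -/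

section Sup

variable {R S Q : Type u} [Ring R] [Ring S] [Ring Q]

/-- The elements `s` of `S` such that each `s * f r` has enough denominators form a subring. -/
def denominatorSubring (f : R →+* S) : Subring S where
  carrier := {s | ∀ r, (1 : S) ∈ Submodule.span Sᵐᵒᵖ (f '' {x | s * f r * f x ∈ f.range})}
  zero_mem' r := Submodule.subset_span ⟨1, ⟨0, by simp⟩, map_one f⟩
  one_mem' r := Submodule.subset_span ⟨1, ⟨r, by simp⟩, map_one f⟩
  neg_mem' {s} hs r := by
    simpa only [Set.mem_ofPred_eq, neg_mul, neg_mem_iff] using hs r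
  add_mem' {s t} hs ht r := by
    -- Having cleared `s * f r` by `x`, one needs denominators of `t * f (r * x)`; the quantifier
    -- over `r` in the carrier provides them.
    refine one_mem_span_image_of_forall (hs r) fun x hx =>
      Submodule.span_mono (Set.image_mono fun y hy => ?_) (ht (r * x))
    have h1 := mul_mem (S := Subring S) (s := f.range) hx ⟨y, rfl⟩
    have := add_mem h1 hy
    simpa only [Set.mem_ofPred_eq, map_mul, add_mul, mul_assoc] using this
  mul_mem' {s t} hs ht r := by
    -- If `t * f r * f x = f a`, then a denominator of `s * f a` completes one of `s * t * f r`.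
    refine one_mem_span_image_of_forall (ht r) fun x hx => ?_
    obtain ⟨a, ha⟩ := hx
    refine Submodule.span_mono (Set.image_mono fun y hy => ?_) (hs a)
    simpa only [Set.mem_ofPred_eq, map_mul, ha, mul_assoc] using hy

theorem map_mem_span_image (g : S →+* Q) {A : Set S} {s : S} (hs : s ∈ Submodule.span Sᵐᵒᵖ A) :
    g s ∈ Submodule.span Qᵐᵒᵖ (g '' A) := by
  induction hs using Submodule.span_induction with
  | mem x hx => exact Submodule.subset_span ⟨x, hx, rfl⟩
  | zero => rw [map_zero]; exact zero_mem _
  | add x y _ _ hx hy => rw [map_add]; exact add_mem hx hy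
  | smul a x _ hx =>
    obtain ⟨a, rfl⟩ := op_surjective a
    rw [op_smul_eq_mul, map_mul]
    exact Submodule.smul_mem _ (op (g a)) hx

/-- Each member `S` of the family lies in `denominatorSubring`, since `s * f r` stays in `S` and its
denominators there still generate the unit ideal in the larger ring. -/
theorem hasDenominators_codRestrict_sSup (f : R →+* Q) {𝒮 : Set (Subring Q)}
    (h𝒮 : ∀ S ∈ 𝒮, ∃ h : ∀ r, f r ∈ S, HasDenominators (f.codRestrict S h))
    (h : ∀ r, f r ∈ sSup 𝒮) : HasDenominators (f.codRestrict (sSup 𝒮) h) := by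
  have key : sSup 𝒮 ≤ (denominatorSubring (f.codRestrict (sSup 𝒮) h)).map (sSup 𝒮).subtype := by
    refine sSup_le fun S hS s hs => ?_
    obtain ⟨hf, hd⟩ := h𝒮 S hS
    refine ⟨⟨s, le_sSup hS hs⟩, fun r => ?_, rfl⟩
    have := map_mem_span_image (Subring.inclusion (le_sSup hS))
      (hd (⟨s, hs⟩ * f.codRestrict S hf r))
    rw [map_one] at this
    refine Submodule.span_mono ?_ this
    rintro _ ⟨_, ⟨x, ⟨y, hy⟩, rfl⟩, rfl⟩
    have hy' : f y = s * f r * f x := congrArg Subtype.val hy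
    exact ⟨x, ⟨y, Subtype.ext hy'⟩, rfl⟩
  intro s
  obtain ⟨t, ht, hts⟩ := key s.2
  obtain rfl : t = s := Subtype.ext hts
  simpa using ht 1

/-- The equalizer of two homomorphisms agreeing on `R` is a subring containing every member of the
family. -/
theorem isRingEpi_codRestrict_sSup (f : R →+* Q) {𝒮 : Set (Subring Q)}
    (h𝒮 : ∀ S ∈ 𝒮, ∃ h : ∀ r, f r ∈ S, IsRingEpi (f.codRestrict S h))
    (h : ∀ r, f r ∈ sSup 𝒮) : IsRingEpi (f.codRestrict (sSup 𝒮) h) := by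
  intro T _ a b hab
  have key : sSup 𝒮 ≤ (a.eqLocus b).map (sSup 𝒮).subtype := by
    refine sSup_le fun S hS s hs => ?_
    obtain ⟨hf, hd⟩ := h𝒮 S hS
    refine ⟨⟨s, le_sSup hS hs⟩, ?_, rfl⟩
    have := hd T (a.comp (Subring.inclusion (le_sSup hS))) (b.comp (Subring.inclusion (le_sSup hS)))
      (RingHom.ext fun r => DFunLike.congr_fun hab r)
    exact DFunLike.congr_fun this ⟨s, hs⟩
  ext s
  obtain ⟨t, ht, hts⟩ := key s.2
  obtain rfl : t = s := Subtype.ext hts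
  exact ht

theorem isPerfectRight_codRestrict_sSup {f : R →+* Q} (hf : Function.Injective f)
    {𝒮 : Set (Subring Q)} (h𝒮 : ∀ S ∈ 𝒮, ∃ h : ∀ r, f r ∈ S, IsPerfectRight (f.codRestrict S h))
    (h : ∀ r, f r ∈ sSup 𝒮) : IsPerfectRight (f.codRestrict (sSup 𝒮) h) :=
  ⟨isRingEpi_codRestrict_sSup f (fun S hS => (h𝒮 S hS).imp fun _ h => h.1) h,
    (hasDenominators_codRestrict_sSup f
      (fun S hS => (h𝒮 S hS).imp fun _ h => h.hasDenominators) h).makesLeftFlat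
        fun _ _ hab => hf (congrArg Subtype.val hab)⟩

theorem isPerfectLeft_codRestrict_sSup {f : R →+* Q} (hf : Function.Injective f)
    {𝒮 : Set (Subring Q)} (h𝒮 : ∀ S ∈ 𝒮, ∃ h : ∀ r, f r ∈ S, IsPerfectLeft (f.codRestrict S h))
    (h : ∀ r, f r ∈ sSup 𝒮) : IsPerfectLeft (f.codRestrict (sSup 𝒮) h) := by
  refine ⟨isRingEpi_codRestrict_sSup f (fun S hS => (h𝒮 S hS).imp fun _ h => h.1) h, ?_⟩
  have hop := Subring.op_sSup 𝒮
  have h' : ∀ r, RingHom.op f r ∈ sSup (Subring.unop ⁻¹' 𝒮) := fun r => by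
    rw [← hop]; exact h (unop r)
  have := isPerfectRight_codRestrict_sSup (f := RingHom.op f) (𝒮 := Subring.unop ⁻¹' 𝒮)
    (fun a b hab => unop_injective (hf (op_injective hab))) (by
      intro S' hS
      obtain ⟨S, rfl⟩ := Subring.opEquiv.surjective S'
      obtain ⟨hf, he, hr⟩ := h𝒮 S hS
      refine ⟨fun r => hf (unop r), ?_, ?_⟩
      · exact he.op.of_equiv S.mopRingEquivOp fun r => rfl
      · exact (makesRightFlat_iff_makesLeftFlat_op.1 hr).of_equiv S.mopRingEquivOp fun r => rfl) h'
  refine makesRightFlat_iff_makesLeftFlat_op.2 (this.2.of_equiv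
    ((RingEquiv.subringCongr hop.symm).trans (sSup 𝒮).mopRingEquivOp.symm) fun r => rfl)

end Sup

/-! ### Comparison of the three total rings of quotients. -/

section Main

variable {R : Type u} [Ring R]

/-- Linearity `g (j x) = g (j) x`: a class acts on its domain by multiplication in the quotient
ring. -/
theorem mk_mul_toQmaxRight (g : DensePMap Rᵐᵒᵖ R) (j : g.domain) :
    DenseEnd.mk g * toQmaxRight R j = toQmaxRight R (g.toFun j) := by
  refine DenseEnd.mk_eq_iff.2 fun x hx _ => ?_
  exact g.toFun.map_smul (op x) j

theorem toQmaxLeft_mul_mk (f : DensePMap R R) (i : f.domain) :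
    toQmaxLeft R i * op (DenseEnd.mk f) = toQmaxLeft R (f.toFun i) := by
  refine congrArg op (DenseEnd.mk_eq_iff.2 fun x hx _ => ?_)
  exact f.toFun.map_smul x i

theorem IsDenseSub.eq_zero_of_mul_right {D : Submodule Rᵐᵒᵖ R} (hD : IsDenseSub D) {x : R}
    (h : ∀ j ∈ D, x * j = 0) : x = 0 := by
  by_contra hx
  -- Density with `y = 1` puts the scalar `a` itself in `D`.
  obtain ⟨a, ha, ha'⟩ := hD x 1 hx
  obtain ⟨a, rfl⟩ := op_surjective a
  exact ha (h a (by simpa using ha'))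

theorem IsDenseSub.eq_zero_of_mul_left {D : Submodule R R} (hD : IsDenseSub D) {x : R}
    (h : ∀ i ∈ D, i * x = 0) : x = 0 := by
  by_contra hx
  obtain ⟨a, ha, ha'⟩ := hD x 1 hx
  exact ha (h a (by simpa using ha'))

variable (R) in
/-- The projection of the maximal symmetric to the maximal right ring of quotients. -/
def qmaxSymmToRight : QmaxSymm R →+* QmaxRight R :=
  (RingHom.snd (QmaxLeft R) (QmaxRight R)).comp (QmaxSymm R).subtype

variable (R) in
/-- The projection of the maximal symmetric to the maximal left ring of quotients. -/
def qmaxSymmToLeft : QmaxSymm R →+* QmaxLeft R :=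
  (RingHom.fst (QmaxLeft R) (QmaxRight R)).comp (QmaxSymm R).subtype

theorem qmaxSymmToRight_injective : Function.Injective (qmaxSymmToRight R) := by
  rw [injective_iff_map_eq_zero]
  rintro ⟨_, f, g, h, rfl⟩ hg
  have hg : DenseEnd.mk g = 0 := hg
  refine Subtype.ext (Prod.ext (congrArg op (DenseEnd.mk_eq_iff.2 fun x hx _ => ?_)) hg)
  refine g.dense.eq_zero_of_mul_right fun j hj => (h ⟨x, hx⟩ ⟨j, hj⟩).trans ?_
  rw [DenseEnd.mk_eq_iff.1 (hg.trans DenseEnd.mk_zero.symm) j hj trivial]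
  exact mul_zero x

theorem qmaxSymmToLeft_injective : Function.Injective (qmaxSymmToLeft R) := by
  rw [injective_iff_map_eq_zero]
  rintro ⟨_, f, g, h, rfl⟩ hf
  have hf : DenseEnd.mk f = 0 := op_injective hf
  refine Subtype.ext (Prod.ext (congrArg op hf) (DenseEnd.mk_eq_iff.2 fun x hx _ => ?_))
  refine f.dense.eq_zero_of_mul_left fun i hi => (h ⟨i, hi⟩ ⟨x, hx⟩).symm.trans ?_
  rw [DenseEnd.mk_eq_iff.1 (hf.trans DenseEnd.mk_zero.symm) i hi trivial]
  exact zero_mul x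

theorem QtotSymm_le_comap_right : QtotSymm R ≤ (QtotRight R).comap (qmaxSymmToRight R) := by
  refine sSup_le fun S hS => Subring.map_le_iff_le_comap.1 (le_sSup ?_)
  obtain ⟨h, he, hl, -⟩ := hS
  let e : S ≃+* S.map (qmaxSymmToRight R) :=
    S.equivMapOfInjective (qmaxSymmToRight R) qmaxSymmToRight_injective
  refine ⟨fun r => ⟨_, h r, rfl⟩, ?_, ?_⟩
  · exact he.of_equiv e fun r => rfl
  · exact hl.of_equiv e fun r => rfl

theorem QtotSymm_le_comap_left : QtotSymm R ≤ (QtotLeft R).comap (qmaxSymmToLeft R) := by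
  refine sSup_le fun S hS => Subring.map_le_iff_le_comap.1 (le_sSup ?_)
  obtain ⟨h, he, -, hr⟩ := hS
  let e : S ≃+* S.map (qmaxSymmToLeft R) :=
    S.equivMapOfInjective (qmaxSymmToLeft R) qmaxSymmToLeft_injective
  refine ⟨fun r => ⟨_, h r, rfl⟩, ?_, ?_⟩
  · exact he.of_equiv e fun r => rfl
  · exact hr.of_equiv e fun r => rfl

variable (R) in
/-- The embedding of the total symmetric into the total right ring of quotients. -/
def qtotSymmToRight : QtotSymm R →+* QtotRight R :=
  (qmaxSymmToRight R).restrict (QtotSymm R) (QtotRight R) fun _ hx => QtotSymm_le_comap_right hx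

variable (R) in
/-- The embedding of the total symmetric into the total left ring of quotients. -/
def qtotSymmToLeft : QtotSymm R →+* QtotLeft R :=
  (qmaxSymmToLeft R).restrict (QtotSymm R) (QtotLeft R) fun _ hx => QtotSymm_le_comap_left hx

theorem isPerfectRight_toQtotRight : IsPerfectRight (toQtotRight R) :=
  isPerfectRight_codRestrict_sSup (toQmaxRight_injective R) (fun _ h => h) _

theorem isPerfectLeft_toQtotLeft : IsPerfectLeft (toQtotLeft R) :=
  isPerfectLeft_codRestrict_sSup (toQmaxLeft_injective R) (fun _ h => h) _

theorem isRingEpi_toQtotSymm : IsRingEpi (toQtotSymm R) :=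
  isRingEpi_codRestrict_sSup _ (fun _ h => h.imp fun _ h => h.1) _

theorem pair_mem_QmaxSymm (e : QtotRight R ≃+* QtotLeft R)
    (he : ∀ r : R, e (toQtotRight R r) = toQtotLeft R r)
    (x : QtotRight R) :
    ((e x : QmaxLeft R), (x : QmaxRight R)) ∈ QmaxSymm R := by
  obtain ⟨g, hg⟩ := DenseEnd.mk_surjective (x : QmaxRight R)
  obtain ⟨f, hf⟩ := DenseEnd.mk_surjective (unop (e x : QmaxLeft R))
  have hf : op (DenseEnd.mk f) = (e x : QmaxLeft R) := congrArg op hf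
  refine ⟨f, g, fun i j => ?_, Prod.ext hf.symm hg.symm⟩
  have h1 : x * toQtotRight R j = toQtotRight R (g.toFun j) := Subtype.ext <| by
    change (x : QmaxRight R) * toQmaxRight R j = toQmaxRight R (g.toFun j)
    rw [← hg, mk_mul_toQmaxRight]
  have h2 : toQtotLeft R i * e x = toQtotLeft R (f.toFun i) := Subtype.ext <| by
    change toQmaxLeft R i * (e x : QmaxLeft R) = toQmaxLeft R (f.toFun i)
    rw [← hf, toQmaxLeft_mul_mk]
  -- Compatibility is associativity: `f(i) j = (i e(x)) j = i e(x j) = i g(j)`, read in the total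
  -- left ring.
  have h3 : toQtotLeft R (f.toFun i * j) = toQtotLeft R (i * g.toFun j) := by
    rw [map_mul, ← h2, mul_assoc, ← he j, ← map_mul, h1, he, ← map_mul]
  exact toQmaxLeft_injective R (congrArg Subtype.val h3)

/-- An isomorphism over `R` between the total right and left rings of quotients embeds the former
into the maximal symmetric ring of quotients. -/
def qtotRightToQmaxSymm (e : QtotRight R ≃+* QtotLeft R)
    (he : ∀ r : R, e (toQtotRight R r) = toQtotLeft R r) : QtotRight R →+* QmaxSymm R :=
  (((QtotLeft R).subtype.comp e.toRingHom).prod (QtotRight R).subtype).codRestrict (QmaxSymm R)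
    (pair_mem_QmaxSymm e he)

theorem qtotRightToQmaxSymm_mem (e : QtotRight R ≃+* QtotLeft R)
    (he : ∀ r : R, e (toQtotRight R r) = toQtotLeft R r)
    (x : QtotRight R) : qtotRightToQmaxSymm e he x ∈ QtotSymm R := by
  have hinj : Function.Injective (qtotRightToQmaxSymm e he) := fun a b hab =>
    Subtype.ext (congrArg (fun p : QmaxSymm R => p.1.2) hab)
  have hr : ∀ r, qtotRightToQmaxSymm e he (toQtotRight R r) = toQmaxSymm R r := fun r =>
    Subtype.ext (Prod.ext (congrArg Subtype.val (he r)) rfl)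
  let E : QtotRight R ≃+* (qtotRightToQmaxSymm e he).range :=
    RingEquiv.ofBijective _ (codRestrict_range_bijective hinj)
  have hE : ∀ (h : ∀ r, toQmaxSymm R r ∈ (qtotRightToQmaxSymm e he).range) (r : R),
      E (toQtotRight R r) = (toQmaxSymm R).codRestrict _ h r := fun _ r => Subtype.ext (hr r)
  -- Only this half of perfectness comes from the left-hand ring, pulled back along `e`.
  have hflat : MakesRightFlat (toQtotRight R) :=
    isPerfectLeft_toQtotLeft.2.of_equiv e.symm fun r => by rw [← he, e.symm_apply_apply]
  exact (le_sSup ⟨fun r => ⟨_, hr r⟩, isPerfectRight_toQtotRight.1.of_equiv E (hE _),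
    isPerfectRight_toQtotRight.2.of_equiv E (hE _), hflat.of_equiv E (hE _)⟩ :
      (qtotRightToQmaxSymm e he).range ≤ QtotSymm R) ⟨x, rfl⟩

end Main

end QuotRing

theorem mainTheorem5 (R : Type u) [Ring R] :
    ∃ (φ : QuotRing.QtotSymm R →+* QuotRing.QtotRight R)
      (ψ : QuotRing.QtotSymm R →+* QuotRing.QtotLeft R),
      Function.Injective φ ∧ φ.comp (QuotRing.toQtotSymm R) = QuotRing.toQtotRight R ∧
      Function.Injective ψ ∧ ψ.comp (QuotRing.toQtotSymm R) = QuotRing.toQtotLeft R ∧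
      ∀ e : QuotRing.QtotRight R ≃+* QuotRing.QtotLeft R,
        (∀ r : R, e (QuotRing.toQtotRight R r) = QuotRing.toQtotLeft R r) →
          Function.Bijective φ ∧ Function.Bijective ψ ∧ ∀ x, e (φ x) = ψ x := by
  have hφ : Function.Injective (QuotRing.qtotSymmToRight R) := fun a b hab =>
    Subtype.ext (QuotRing.qmaxSymmToRight_injective (congrArg Subtype.val hab))
  have hψ : Function.Injective (QuotRing.qtotSymmToLeft R) := fun a b hab =>
    Subtype.ext (QuotRing.qmaxSymmToLeft_injective (congrArg Subtype.val hab))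
  refine ⟨QuotRing.qtotSymmToRight R, QuotRing.qtotSymmToLeft R, hφ, rfl, hψ, rfl,
    fun e he => ?_⟩
  have comm := QuotRing.isRingEpi_toQtotSymm (R := R) _
    (e.toRingHom.comp (QuotRing.qtotSymmToRight R)) (QuotRing.qtotSymmToLeft R) (RingHom.ext he)
  -- The preimage of `x` is the pair `(e x, x)`.
  have hs : Function.Surjective (QuotRing.qtotSymmToRight R) := fun x =>
    ⟨⟨_, QuotRing.qtotRightToQmaxSymm_mem e he x⟩, rfl⟩
  refine ⟨⟨hφ, hs⟩, ⟨hψ, ?_⟩, DFunLike.congr_fun comm⟩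
  rw [← comm]
  exact e.surjective.comp hs
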